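/- For a discrete group $\Gamma$ write the elements of $L^p(\Gamma)$, $p=1,2$, as formal series $\sum_{\gamma} x_\gamma \gamma$ with $\sum_\gamma |x_\gamma|^p<\infty$. Let $L^1(\Gamma)^\times$ be the group of units of the convolution algebra $L^1(\Gamma)$, and let $\mathcal N\Gamma$ be the algebra of bounded operators on $L^2(\Gamma)$ commuting with left translation by $\Gamma$, with trace $\tau(A)=(Ae,e)$. With $R_\gamma(x)=x\gamma$, let $r:L^1(\Gamma)\to\mathcal N\Gamma$ be $r(\sum f_\gamma\gamma)=\sum f_\gamma R_{\gamma^{-1}}$. For $A\in\mathcal N\Gamma$ the Fuglede--Kadison determinant is $\det_{\mathcal N\Gamma}A=\lim_{\varepsilon\to0+}\exp\tau(\log(|A|+\varepsilon))$, where $|A|=(A^*A)^{1/2}$ (for invertible $A$ this is $\exp\tau(\log|A|)$); for $f \in L^1(\Gamma)$ write $\det_{\mathcal N\Gamma}f=\det_{\mathcal N\Gamma}r(f)$. For a sequence of normal subgroups $K_n$ of $\Gamma$, $K_n\to e$ means that $e$ is the only element of $\Gamma$ contained in infinitely many $K_n$. Let $\Gamma$ be a countable residually finite group. (a) There is a sequence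 $(K_n)$ of normal subgroups of finite index in $\Gamma$ with $K_n\to e$. (b) Let $(K_n)$ be any such sequence, put $\Gamma_n=\Gamma/K_n$ and, for $f\in L^1(\Gamma)$, let $f_n\in L^1(\Gamma_n)=\mathbb C\Gamma_n$ be the image of $f$ under summation along the fibres of $\Gamma\to\Gamma_n$. Then for every $f\in L^1(\Gamma)^\times$ $$\det\nolimits_{\mathcal N\Gamma} f=\lim_{n\to\infty}|\det r(f_n)|^{1/|\Gamma_n|},$$ where $\det r(f_n)$ is the ordinary determinant of the endomorphism $r(f_n)$ of the finite-dimensional complex vector space $\mathbb C\Gamma_n$. (c) For every finite group $G$ and every $h\in\mathbb CG=L^1(G)$, $$\det\nolimits_{\mathcal NG}h=|\det r(h)|^{1/|G|}.$$ -/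

import Mathlib

open Filter Topology

noncomputable section

namespace GroupVN

/-- `L¹(Γ)`: absolutely summable families `∑ f_γ γ`. -/
abbrev L1 (Γ : Type*) := lp (fun _ : Γ => ℂ) 1

/-- The Hilbert space `L²(Γ)` of square summable families `∑ x_γ γ`. -/
abbrev L2 (Γ : Type*) := lp (fun _ : Γ => ℂ) 2

lemma L1.summable_norm {Γ : Type*} (f : L1 Γ) : Summable fun γ => ‖f γ‖ := by
  simpa using (lp.memℓp f).summable (by simp)

lemma memℓp_one_of_summable {Γ : Type*} {f : Γ → ℂ} (hf : Summable fun γ => ‖f γ‖) :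
    Memℓp f 1 := memℓp_gen (by simpa using hf)

/-! ### The Banach algebra structure of `L¹(Γ)` -/

section Convolution

variable {Γ : Type*} [Group Γ]

lemma summable_conv_aux (f g : L1 Γ) :
    Summable fun p : Γ × Γ => ‖f p.2 * g (p.2⁻¹ * p.1)‖ := by
  have h := (L1.summable_norm f).mul_of_nonneg (L1.summable_norm g) (fun _ => norm_nonneg _)
    (fun _ => norm_nonneg _)
  let e : Γ × Γ ≃ Γ × Γ :=
    { toFun := fun p => (p.2, p.2⁻¹ * p.1)
      invFun := fun q => (q.1 * q.2, q.1)
      left_inv := fun p => by simp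
      right_inv := fun q => by simp }
  have h2 := e.summable_iff.mpr h
  refine h2.congr fun p => ?_
  simp [e]

/-- The product of `L¹(Γ)`: `(f * g)_γ = ∑_δ f_δ g_{δ⁻¹γ}`, that is, the bilinear continuous
extension of the multiplication of `Γ`. -/
def conv (f g : L1 Γ) : L1 Γ :=
  ⟨fun γ => ∑' δ : Γ, f δ * g (δ⁻¹ * γ), by
    refine memℓp_one_of_summable ?_
    have h := summable_conv_aux f g
    refine Summable.of_nonneg_of_le (fun _ => norm_nonneg _) (fun γ => ?_) h.prod
    exact norm_tsum_le_tsum_norm (h.prod_factor γ)⟩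

open Classical in
/-- The unit element `e` of `L¹(Γ)`. -/
def one : L1 Γ := lp.single 1 (1 : Γ) (1 : ℂ)

/-- `f ∈ L¹(Γ)^×`: `f` has a two-sided inverse in `L¹(Γ)`. -/
def IsL1Unit (f : L1 Γ) : Prop := ∃ g : L1 Γ, conv f g = one ∧ conv g f = one

end Convolution

lemma summable_fibre {Γ Γ' : Type*} (φ : Γ → Γ') (f : L1 Γ) :
    Summable fun γ' : Γ' => ‖∑' γ : {γ : Γ // φ γ = γ'}, f γ‖ := by
  have h : Summable fun p : Σ γ' : Γ', {γ : Γ // φ γ = γ'} => ‖f p.2‖ :=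
    (Equiv.sigmaFiberEquiv φ).summable_iff.mpr (L1.summable_norm f)
  refine Summable.of_nonneg_of_le (fun _ => norm_nonneg _) (fun γ' => ?_) h.sigma
  exact norm_tsum_le_tsum_norm (h.sigma_factor γ')

/-- Integration along the fibres `φ_* : L¹(Γ) → L¹(Γ')`,
`(φ_* f)_{γ'} = ∑_{γ ∈ φ⁻¹(γ')} f_γ`. -/
def pushforward {Γ Γ' : Type*} [Group Γ] [Group Γ'] (φ : Γ →* Γ') (f : L1 Γ) : L1 Γ' :=
  ⟨fun γ' => ∑' γ : {γ : Γ // φ γ = γ'}, f γ, memℓp_one_of_summable (summable_fibre φ f)⟩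

/-! ### Translations and the group von Neumann algebra -/

section Translation

variable {Γ : Type*}

/-- The isometry `x ↦ x ∘ σ` of `L²(Γ)` given by a permutation `σ` of `Γ`. -/
def permute (σ : Equiv.Perm Γ) : L2 Γ →ₗᵢ[ℂ] L2 Γ where
  toFun x := ⟨fun γ => x (σ γ),
    memℓp_gen (σ.summable_iff.mpr ((lp.memℓp x).summable (by simp)))⟩
  map_add' x y := rfl
  map_smul' c x := rfl
  norm_map' x := by
    have h2 : 0 < (2 : ENNReal).toReal := by simp
    rw [lp.norm_eq_tsum_rpow h2, lp.norm_eq_tsum_rpow h2]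
    congr 1
    exact σ.tsum_eq (fun γ => ‖x γ‖ ^ (2 : ENNReal).toReal)

variable [Group Γ]

/-- Left translation `x ↦ γx` on `L²(Γ)`, so `(γx)_δ = x_{γ⁻¹δ}`. -/
def leftTranslation (γ : Γ) : L2 Γ →L[ℂ] L2 Γ :=
  (permute (Equiv.mulLeft γ⁻¹)).toContinuousLinearMap

/-- Right translation `R_γ : x ↦ xγ` on `L²(Γ)`, so `(xγ)_δ = x_{δγ⁻¹}`. -/
def rightTranslation (γ : Γ) : L2 Γ →L[ℂ] L2 Γ :=
  (permute (Equiv.mulRight γ⁻¹)).toContinuousLinearMap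

lemma leftTranslation_apply (γ δ : Γ) (x : L2 Γ) : leftTranslation γ x δ = x (γ⁻¹ * δ) := rfl

lemma rightTranslation_apply (γ δ : Γ) (x : L2 Γ) : rightTranslation γ x δ = x (δ * γ⁻¹) := rfl

variable (Γ) in
/-- The von Neumann algebra `𝒩Γ`: the bounded operators on `L²(Γ)` that commute with all left
translations. -/
def groupVN : Subalgebra ℂ (L2 Γ →L[ℂ] L2 Γ) :=
  Subalgebra.centralizer ℂ (Set.range (leftTranslation (Γ := Γ)))

lemma norm_rightTranslation_le (γ : Γ) : ‖rightTranslation γ‖ ≤ 1 :=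
  LinearIsometry.norm_toContinuousLinearMap_le _

lemma summable_regular (f : L1 Γ) : Summable fun γ : Γ => f γ • rightTranslation γ⁻¹ := by
  refine Summable.of_norm_bounded (L1.summable_norm f) fun γ => ?_
  rw [norm_smul]
  exact mul_le_of_le_one_right (norm_nonneg _) (norm_rightTranslation_le _)

lemma rightTranslation_mem (γ : Γ) : rightTranslation γ ∈ groupVN Γ := by
  rw [groupVN, Subalgebra.mem_centralizer_iff]
  rintro _ ⟨δ, rfl⟩
  refine ContinuousLinearMap.ext fun x => lp.ext (funext fun η => ?_)
  simp only [mul_apply_eq_comp, leftTranslation_apply, rightTranslation_apply,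
    mul_assoc]

/-- The representation `r : L¹(Γ) → 𝒩Γ`, `r(∑ f_γ γ) = ∑ f_γ R_{γ⁻¹}`; the series converges
absolutely in operator norm. -/
def regular (f : L1 Γ) : groupVN Γ :=
  ⟨∑' γ : Γ, f γ • rightTranslation γ⁻¹, by
    rw [groupVN, Subalgebra.mem_centralizer_iff]
    rintro _ ⟨δ, rfl⟩
    have hs := summable_regular f
    rw [← hs.tsum_mul_left, ← hs.tsum_mul_right]
    congr 1
    funext γ
    have := (Subalgebra.mem_centralizer_iff ℂ).1 (rightTranslation_mem γ⁻¹)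
      (leftTranslation δ) ⟨δ, rfl⟩
    rw [mul_smul_comm, smul_mul_assoc, this]⟩

end Translation

/-! ### Trace and Fuglede-Kadison determinant -/

section Operators

variable {H : Type*} [NormedAddCommGroup H] [InnerProductSpace ℂ H]

/-- The functional `τ(A) = (Aξ, ξ)` on bounded operators, the scalar product being linear in its
first argument. The canonical trace of `𝒩Γ` is the case `ξ = e`. -/
def vectorTrace (ξ : H) (A : H →L[ℂ] H) : ℂ := inner ℂ ξ (A ξ)

lemma vectorTrace_re_mono (ξ : H) {A B : H →L[ℂ] H} (h : A ≤ B) :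
    (vectorTrace ξ A).re ≤ (vectorTrace ξ B).re := by
  have h' := ((ContinuousLinearMap.le_def A B).1 h).re_inner_nonneg_right ξ
  simp only [sub_apply, inner_sub_right, map_sub] at h'
  simpa [vectorTrace] using h'

variable [CompleteSpace H]

/-- `exp τ(log |A|)` for an invertible operator `A`, where `τ(A) = (Aξ, ξ)`, `|A| = (A*A)^{1/2}` and
the logarithm is taken in the continuous functional calculus. As `log |A|` is self-adjoint, the
number `τ(log |A|)` is real. -/
def detInv (ξ : H) (A : H →L[ℂ] H) : ℝ :=
  Real.exp (vectorTrace ξ (CFC.log (CFC.abs A))).re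

/-- The invertible operator `|A| + ε`. -/
def absAdd (A : H →L[ℂ] H) (ε : ℝ) : H →L[ℂ] H := CFC.abs A + algebraMap ℝ (H →L[ℂ] H) ε

/-- `lim_{ε → 0+} exp τ(log (|A| + ε))` with `τ(A) = (Aξ, ξ)`. The limit exists for every bounded
operator `A`, see `tendsto_vectorDet`. -/
def vectorDet (ξ : H) (A : H →L[ℂ] H) : ℝ :=
  limUnder (𝓝[>] (0 : ℝ)) fun ε : ℝ => detInv ξ (absAdd A ε)

lemma absAdd_pos (A : H →L[ℂ] H) {ε : ℝ} (hε : 0 < ε) : IsStrictlyPositive (absAdd A ε) := by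
  have h : IsStrictlyPositive (algebraMap ℝ (H →L[ℂ] H) ε) :=
    ⟨algebraMap_nonneg _ hε.le, (IsUnit.mk0 ε hε.ne').map _⟩
  exact h.nonneg_add (CFC.abs_nonneg A)

theorem tendsto_vectorDet (ξ : H) (A : H →L[ℂ] H) :
    Tendsto (fun ε : ℝ => detInv ξ (absAdd A ε)) (𝓝[>] 0) (𝓝 (vectorDet ξ A)) := by
  refine tendsto_nhds_limUnder ⟨_, MonotoneOn.tendsto_nhdsGT ?_ ?_⟩
  · intro x hx y hy hxy
    have hxp := absAdd_pos A hx
    have hyp := absAdd_pos A hy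
    simp only [detInv]
    rw [CFC.abs_of_nonneg _ hxp.nonneg, CFC.abs_of_nonneg _ hyp.nonneg]
    refine Real.exp_le_exp.2 (vectorTrace_re_mono ξ (CFC.log_le_log ?_ hxp))
    exact add_le_add_right (algebraMap_mono _ hxy) _
  · refine ⟨0, ?_⟩
    rintro _ ⟨x, -, rfl⟩
    exact (Real.exp_pos _).le

theorem vectorDet_eq_detInv (ξ : H) (A : H →L[ℂ] H) (hA : IsUnit A) :
    vectorDet ξ A = detInv ξ A := by
  have hp : IsStrictlyPositive (CFC.abs A) := by
    refine ⟨CFC.abs_nonneg A, ?_⟩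
    have h : IsUnit (CFC.abs A ^ 2) := by
      rw [CFC.abs_sq]
      exact hA.star.mul hA
    exact (isUnit_pow_iff two_ne_zero).1 h
  have h0 : absAdd A 0 = CFC.abs A := by simp [absAdd]
  have hc : Continuous fun ε : ℝ => absAdd A ε := by
    unfold absAdd
    fun_prop
  have hmem : ∀ ε ∈ Set.Ici (0 : ℝ), IsStrictlyPositive (absAdd A ε) := fun ε hε =>
    hp.add_nonneg (algebraMap_nonneg _ hε)
  have hl : ContinuousOn (fun ε : ℝ => CFC.log (absAdd A ε)) (Set.Ici 0) := by
    exact CFC.continuousOn_log.comp hc.continuousOn fun ε hε =>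
      ⟨(hmem ε hε).nonneg.isSelfAdjoint, (hmem ε hε).isUnit⟩
  have ht : ContinuousOn (fun ε : ℝ => detInv ξ (absAdd A ε)) (Set.Ici 0) := by
    have : ContinuousOn (fun ε : ℝ =>
        Real.exp (vectorTrace ξ (CFC.log (absAdd A ε))).re) (Set.Ici 0) := by
      unfold vectorTrace
      fun_prop
    refine this.congr fun ε hε => ?_
    simp only [detInv]
    rw [CFC.abs_of_nonneg _ (hmem ε hε).nonneg]
  have h1 : Tendsto (fun ε : ℝ => detInv ξ (absAdd A ε)) (𝓝[>] 0) (𝓝 (detInv ξ (absAdd A 0))) :=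
    (ht 0 Set.self_mem_Ici).mono_left (nhdsWithin_mono _ Set.Ioi_subset_Ici_self)
  rw [tendsto_nhds_unique (tendsto_vectorDet ξ A) h1, h0, detInv, detInv,
    CFC.abs_of_nonneg _ (CFC.abs_nonneg A)]

end Operators

open Classical in
/-- The unit element `e ∈ Γ` viewed in `L²(Γ)`. -/
def unitVector {Γ : Type*} [Group Γ] : L2 Γ := lp.single 2 (1 : Γ) (1 : ℂ)

/-- The Fuglede-Kadison determinant `det_{𝒩Γ} A = lim_{ε → 0+} det_{𝒩Γ} (|A| + ε)` of an
arbitrary operator in `𝒩Γ`, formed with the canonical trace `τ(A) = (Ae, e)`. For invertible `A`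
it is `exp τ(log |A|)`, see `vectorDet_eq_detInv`. -/
def fkDet {Γ : Type*} [Group Γ] (A : groupVN Γ) : ℝ :=
  vectorDet (unitVector : L2 Γ) (A : L2 Γ →L[ℂ] L2 Γ)

/-- `K_n → e`: the unit element is the only element of `Γ` that lies in infinitely many `K_n`. -/
def TendsToTrivial {Γ : Type*} [Group Γ] (K : ℕ → Subgroup Γ) : Prop :=
  ∀ γ : Γ, {n | γ ∈ K n}.Infinite ↔ γ = 1

/-- The determinant of `r(h)` as an endomorphism of the finite dimensional complex vector space
`ℂG = L²(G)`, for a finite group `G`. -/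
def finiteDet {G : Type*} [Group G] [Finite G] (h : L1 G) : ℂ :=
  LinearMap.det ((regular h : L2 G →L[ℂ] L2 G) : L2 G →ₗ[ℂ] L2 G)

end GroupVN

end

open Filter Topology

noncomputable section

namespace GroupVN

/-! ### Integrated forms of bounded representations -/

section Integrated

variable {Γ : Type*} [Group Γ] {E : Type*} [NormedRing E] [NormedAlgebra ℂ E]

/-! The determinant of an invertible `A` is `exp (τ(log (A*A)) / 2)`. For `A = r(f)` the operator
`A*A` is the integrated form of `f* * f`, and `r(f_n)` is the integrated form of the same `f` under
the regular representation of `Γ_n` pulled back to `Γ`. With `g` the `L¹` inverse of `f`, the `L¹`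
norms of `f* * f` and `g * g*` confine all these spectra to one compact interval in `(0, ∞)`,
independent of `n` (`spectrum_integrated_subset`). Weierstrass approximation of `log` there reduces
convergence of the determinants to that of moments (`tendsto_vectorTrace_cfc`). A moment is the
trace of a fixed element of `L¹(Γ)`, that is, a sum of coefficients over `K_n`, which tends to the
coefficient at `e` by dominated convergence.

For finite `G`, `|G| τ` is the ordinary trace on operators commuting with left translations, and
`det ∘ exp = exp ∘ tr` gives (c), first for `|A| + ε` and then in the limit, so singular `h` is
covered. -/

/-- The integrated form `f ↦ ∑ f_γ u(γ)` of a homomorphism `u` from `Γ` to a Banach algebra. -/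
def integrated (u : Γ →* E) (f : L1 Γ) : E := ∑' γ, f γ • u γ

lemma summable_norm_integrated {u : Γ →* E} (hu : ∀ γ, ‖u γ‖ ≤ 1) (f : L1 Γ) :
    Summable fun γ => ‖f γ • u γ‖ := by
  refine Summable.of_nonneg_of_le (fun _ => norm_nonneg _) (fun γ => ?_) (L1.summable_norm f)
  rw [norm_smul]
  exact mul_le_of_le_one_right (norm_nonneg _) (hu γ)

lemma norm_integrated_le {u : Γ →* E} (hu : ∀ γ, ‖u γ‖ ≤ 1) (f : L1 Γ) :
    ‖integrated u f‖ ≤ ∑' γ, ‖f γ‖ := by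
  refine (norm_tsum_le_tsum_norm (summable_norm_integrated hu f)).trans ?_
  refine (summable_norm_integrated hu f).tsum_le_tsum (fun γ => ?_) (L1.summable_norm f)
  rw [norm_smul]
  exact mul_le_of_le_one_right (norm_nonneg _) (hu γ)

lemma integrated_one (u : Γ →* E) : integrated u one = 1 := by
  classical
  rw [integrated, tsum_eq_single (1 : Γ)]
  · simp [one]
  · intro γ hγ
    simp [one, lp.single_apply, hγ]

/-- The involution `f*_γ = conj f_{γ⁻¹}` of `L¹(Γ)`. -/
def involution (f : L1 Γ) : L1 Γ :=
  ⟨fun γ => star (f γ⁻¹), memℓp_one_of_summable (by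
    simp only [norm_star]
    exact (Equiv.inv Γ).summable_iff.mpr (L1.summable_norm f))⟩

lemma integrated_involution [StarRing E] [NormedStarGroup E] [StarModule ℂ E] {u : Γ →* E}
    (hstar : ∀ γ, star (u γ) = u γ⁻¹) (f : L1 Γ) :
    integrated u (involution f) = star (integrated u f) := by
  rw [integrated, integrated, tsum_star, ← (Equiv.inv Γ).tsum_eq]
  refine tsum_congr fun γ => ?_
  simp [involution, hstar, star_smul]

variable [CompleteSpace E]

lemma integrated_conv {u : Γ →* E} (hu : ∀ γ, ‖u γ‖ ≤ 1) (f g : L1 Γ) :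
    integrated u (conv f g) = integrated u f * integrated u g := by
  have hs := summable_conv_aux f g
  let F : Γ × Γ → E := fun p => (f p.2 * g (p.2⁻¹ * p.1)) • u p.1
  have hF : Summable F := by
    refine Summable.of_norm_bounded hs fun p => ?_
    rw [norm_smul]
    exact mul_le_of_le_one_right (norm_nonneg _) (hu _)
  let e : Γ × Γ ≃ Γ × Γ :=
    { toFun := fun q => (q.1 * q.2, q.1)
      invFun := fun p => (p.2, p.2⁻¹ * p.1)
      left_inv := fun p => by simp
      right_inv := fun q => by simp }
  have h1 : integrated u (conv f g) = ∑' p, F p := by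
    rw [hF.tsum_prod]
    refine tsum_congr fun γ => ?_
    exact ((hs.prod_factor γ).of_norm.tsum_smul_const (u γ)).symm
  rw [h1, integrated, integrated, tsum_mul_tsum_of_summable_norm (summable_norm_integrated hu f)
    (summable_norm_integrated hu g), ← e.tsum_eq]
  refine tsum_congr fun q => ?_
  simp only [F, e, Equiv.coe_fn_mk, inv_mul_cancel_left, map_mul, smul_mul_smul_comm]

/-- Powers in the convolution algebra. -/
def convPow (f : L1 Γ) : ℕ → L1 Γ
  | 0 => one
  | n + 1 => conv (convPow f n) f

lemma integrated_convPow {u : Γ →* E} (hu : ∀ γ, ‖u γ‖ ≤ 1) (f : L1 Γ) (n : ℕ) :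
    integrated u (convPow f n) = integrated u f ^ n := by
  induction n with
  | zero => simp [convPow, integrated_one]
  | succ n ih => rw [convPow, integrated_conv hu, ih, pow_succ]

/-- Turns every quotient into a representation of the single algebra `L¹(Γ)`, which makes the
estimates uniform in the quotient. -/
lemma integrated_pushforward {Γ' : Type*} [Group Γ'] (φ : Γ →* Γ') {u : Γ' →* E}
    (hu : ∀ γ, ‖u γ‖ ≤ 1) (f : L1 Γ) :
    integrated u (pushforward φ f) = integrated (u.comp φ) f := by
  have hs : Summable fun γ => f γ • (u.comp φ) γ :=
    (summable_norm_integrated (u := u.comp φ) (fun γ => hu _) f).of_norm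
  have hs' := (Equiv.sigmaFiberEquiv φ).summable_iff.mpr hs
  have hf : Summable fun p : Σ γ' : Γ', {γ : Γ // φ γ = γ'} => f p.2 :=
    (Equiv.sigmaFiberEquiv φ).summable_iff.mpr (L1.summable_norm f).of_norm
  refine Eq.trans ?_ (hs'.tsum_sigma.symm.trans ((Equiv.sigmaFiberEquiv φ).tsum_eq
    fun γ => f γ • (u.comp φ) γ))
  refine tsum_congr fun γ' => ?_
  refine ((hf.sigma_factor γ').tsum_smul_const (u γ')).symm.trans (tsum_congr fun γ => ?_)
  rcases γ with ⟨γ, rfl⟩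
  rfl

end Integrated

/-! ### The right regular representation -/

section Regular

variable {Γ : Type*} [Group Γ]

variable (Γ) in
/-- The unitary representation `γ ↦ R_{γ⁻¹}` on `L²(Γ)`. -/
def rightRegular : Γ →* (L2 Γ →L[ℂ] L2 Γ) where
  toFun γ := rightTranslation γ⁻¹
  map_one' := by
    refine ContinuousLinearMap.ext fun x => lp.ext (funext fun η => ?_)
    simp [rightTranslation_apply]
  map_mul' γ δ := by
    refine ContinuousLinearMap.ext fun x => lp.ext (funext fun η => ?_)
    simp [rightTranslation_apply, mul_assoc]

lemma rightRegular_apply (γ η : Γ) (x : L2 Γ) : rightRegular Γ γ x η = x (η * γ) := by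
  simp [rightRegular, rightTranslation_apply]

lemma norm_rightRegular_le (γ : Γ) : ‖rightRegular Γ γ‖ ≤ 1 := norm_rightTranslation_le _

lemma star_rightRegular (γ : Γ) : star (rightRegular Γ γ) = rightRegular Γ γ⁻¹ := by
  rw [ContinuousLinearMap.star_eq_adjoint]
  symm
  rw [ContinuousLinearMap.eq_adjoint_iff]
  intro x y
  rw [lp.inner_eq_tsum, lp.inner_eq_tsum, ← (Equiv.mulRight γ).tsum_eq]
  refine tsum_congr fun η => ?_
  simp [rightRegular_apply]

lemma coe_regular (f : L1 Γ) :
    (regular f : L2 Γ →L[ℂ] L2 Γ) = integrated (rightRegular Γ) f := rfl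

open Classical in
lemma unitVector_apply (γ : Γ) : (unitVector : L2 Γ) γ = if γ = 1 then 1 else 0 := by
  by_cases h : γ = 1
  · subst h; simp [unitVector]
  · simp [unitVector, lp.single_apply, h]

lemma vectorTrace_unitVector (A : L2 Γ →L[ℂ] L2 Γ) :
    vectorTrace unitVector A = A unitVector 1 := by
  classical
  rw [vectorTrace, unitVector, lp.inner_single_left]
  simp

lemma norm_unitVector : ‖(unitVector : L2 Γ)‖ = 1 := by
  classical
  rw [unitVector, lp.norm_single (by simp)]
  simp

open Classical in
lemma vectorTrace_integrated {Γ' : Type*} [Group Γ'] (φ : Γ →* Γ') (f : L1 Γ) :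
    vectorTrace unitVector (integrated ((rightRegular Γ').comp φ) f) =
      ∑' γ, if φ γ = 1 then f γ else 0 := by
  have hs : Summable fun γ => f γ • ((rightRegular Γ').comp φ) γ :=
    (summable_norm_integrated (u := (rightRegular Γ').comp φ)
      (fun γ => norm_rightRegular_le _) f).of_norm
  have := ((innerSL ℂ (unitVector : L2 Γ')).comp
    (ContinuousLinearMap.apply ℂ (L2 Γ') (unitVector : L2 Γ'))).map_tsum hs
  refine this.trans (tsum_congr fun γ => ?_)
  have h2 := vectorTrace_unitVector (rightRegular Γ' (φ γ))
  rw [rightRegular_apply, one_mul, unitVector_apply] at h2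
  simp only [vectorTrace] at h2
  simp [h2]

/-- The trace sums `f` over `ker (φ n)`. Each `γ ≠ 1` eventually leaves the kernel, and `‖f γ‖`
dominates. -/
lemma tendsto_vectorTrace_integrated {Γ' : ℕ → Type*} [∀ n, Group (Γ' n)]
    (φ : ∀ n, Γ →* Γ' n) (hφ : ∀ γ, γ ≠ 1 → ∀ᶠ n in atTop, φ n γ ≠ 1) (f : L1 Γ) :
    Tendsto (fun n => vectorTrace unitVector (integrated ((rightRegular (Γ' n)).comp (φ n)) f))
      atTop (𝓝 (vectorTrace unitVector (integrated (rightRegular Γ) f))) := by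
  classical
  have h0 := vectorTrace_integrated (MonoidHom.id Γ) f
  rw [MonoidHom.comp_id] at h0
  rw [h0]
  simp only [vectorTrace_integrated]
  refine tendsto_tsum_of_dominated_convergence (L1.summable_norm f) (fun γ => ?_)
    (Eventually.of_forall fun n γ => ?_)
  · by_cases hγ : γ = 1
    · simp [hγ]
    · simp only [MonoidHom.id_apply, hγ, if_false]
      refine tendsto_const_nhds.congr' ?_
      filter_upwards [hφ γ hγ] with n hn
      simp [hn]
  · split_ifs <;> simp

end Regular

/-! ### Functional calculus, traces and determinants of operators -/

section Approximation

variable {H : Type*} [NormedAddCommGroup H] [InnerProductSpace ℂ H]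

lemma vectorTrace_add (ξ : H) (A B : H →L[ℂ] H) :
    vectorTrace ξ (A + B) = vectorTrace ξ A + vectorTrace ξ B := by
  simp [vectorTrace]

lemma vectorTrace_sub (ξ : H) (A B : H →L[ℂ] H) :
    vectorTrace ξ (A - B) = vectorTrace ξ A - vectorTrace ξ B := by
  simp [vectorTrace]

lemma vectorTrace_real_smul (ξ : H) (c : ℝ) (A : H →L[ℂ] H) :
    vectorTrace ξ (c • A) = c * vectorTrace ξ A := by
  rw [vectorTrace, vectorTrace, smul_apply, ← Complex.coe_smul,
    inner_smul_right]

lemma norm_vectorTrace_le {ξ : H} (hξ : ‖ξ‖ = 1) (A : H →L[ℂ] H) : ‖vectorTrace ξ A‖ ≤ ‖A‖ := by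
  have h1 := norm_inner_le_norm (𝕜 := ℂ) ξ (A ξ)
  have h2 := A.le_opNorm ξ
  rw [hξ] at h1 h2
  rw [vectorTrace]
  linarith

lemma tendsto_vectorTrace_aeval {ξ : H} {B : H →L[ℂ] H} {K : ℕ → Type*}
    [∀ n, NormedAddCommGroup (K n)] [∀ n, InnerProductSpace ℂ (K n)] {η : ∀ n, K n}
    {C : ∀ n, K n →L[ℂ] K n}
    (h : ∀ k : ℕ, Tendsto (fun n => vectorTrace (η n) (C n ^ k)) atTop (𝓝 (vectorTrace ξ (B ^ k))))
    (p : Polynomial ℝ) :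
    Tendsto (fun n => vectorTrace (η n) (Polynomial.aeval (C n) p)) atTop
      (𝓝 (vectorTrace ξ (Polynomial.aeval B p))) := by
  induction p using Polynomial.induction_on' with
  | add p q hp hq =>
    simp only [map_add, vectorTrace_add]
    exact hp.add hq
  | monomial k c =>
    simp only [Polynomial.aeval_monomial, ← Algebra.smul_def, vectorTrace_real_smul]
    exact (h k).const_mul _

variable [CompleteSpace H]

lemma norm_cfc_sub_aeval_le {B : H →L[ℂ] H} (hB : IsSelfAdjoint B) {a b ε : ℝ} (hε : 0 ≤ ε)
    (hs : spectrum ℝ B ⊆ Set.Icc a b) {g : ℝ → ℝ} (hg : ContinuousOn g (Set.Icc a b))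
    {p : Polynomial ℝ} (hp : ∀ x ∈ Set.Icc a b, |p.eval x - g x| ≤ ε) :
    ‖cfc g B - Polynomial.aeval B p‖ ≤ ε := by
  rw [← cfc_polynomial p B hB, ← cfc_sub g p.eval B (hg.mono hs) p.continuous.continuousOn]
  refine norm_cfc_le hε fun x hx => ?_
  rw [Real.norm_eq_abs, abs_sub_comm]
  exact hp x (hs hx)

lemma tendsto_vectorTrace_cfc {ξ : H} (hξ : ‖ξ‖ = 1) {B : H →L[ℂ] H} (hB : IsSelfAdjoint B)
    {K : ℕ → Type*} [∀ n, NormedAddCommGroup (K n)] [∀ n, InnerProductSpace ℂ (K n)]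
    [∀ n, CompleteSpace (K n)] {η : ∀ n, K n} (hη : ∀ n, ‖η n‖ = 1) {C : ∀ n, K n →L[ℂ] K n}
    (hC : ∀ n, IsSelfAdjoint (C n)) {a b : ℝ} (hsB : spectrum ℝ B ⊆ Set.Icc a b)
    (hsC : ∀ n, spectrum ℝ (C n) ⊆ Set.Icc a b) {g : ℝ → ℝ} (hg : ContinuousOn g (Set.Icc a b))
    (h : ∀ k : ℕ,
      Tendsto (fun n => vectorTrace (η n) (C n ^ k)) atTop (𝓝 (vectorTrace ξ (B ^ k)))) :
    Tendsto (fun n => vectorTrace (η n) (cfc g (C n))) atTop (𝓝 (vectorTrace ξ (cfc g B))) := by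
  rw [Metric.tendsto_atTop]
  intro ε hε
  -- Three errors of at most `ε / 4`: two from replacing `g` by `p`, one from the moments.
  obtain ⟨p, hp⟩ := exists_polynomial_near_of_continuousOn a b g hg (ε / 4) (by positivity)
  have hp' : ∀ x ∈ Set.Icc a b, |p.eval x - g x| ≤ ε / 4 := fun x hx => (hp x hx).le
  obtain ⟨N, hN⟩ := Metric.tendsto_atTop.1 (tendsto_vectorTrace_aeval h p) (ε / 4) (by positivity)
  refine ⟨N, fun n hn => ?_⟩
  have h1 := (norm_vectorTrace_le (hη n) _).trans
    (norm_cfc_sub_aeval_le (hC n) (by positivity) (hsC n) hg hp')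
  have h2 := (norm_vectorTrace_le hξ _).trans
    (norm_cfc_sub_aeval_le hB (by positivity) hsB hg hp')
  have h3 := hN n hn
  rw [vectorTrace_sub, ← dist_eq_norm] at h1 h2
  rw [dist_comm] at h2
  have h4 := dist_triangle4 (vectorTrace (η n) (cfc g (C n)))
    (vectorTrace (η n) (Polynomial.aeval (C n) p)) (vectorTrace ξ (Polynomial.aeval B p))
    (vectorTrace ξ (cfc g B))
  linarith

lemma spectrum_subset_Icc {B C : H →L[ℂ] H} (hB : 0 ≤ B) (hBC : B * C = 1) (hCB : C * B = 1)
    {b c : ℝ} (hb : ‖B‖ ≤ b) (hc : ‖C‖ ≤ c) : spectrum ℝ B ⊆ Set.Icc c⁻¹ b := by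
  -- Equality fails when `H` is the zero space.
  have hone : ‖(1 : H →L[ℂ] H)‖ ≤ 1 := ContinuousLinearMap.norm_id_le
  have hle : ∀ {X : H →L[ℂ] H} {x : ℝ}, x ∈ spectrum ℝ X → |x| ≤ ‖X‖ := fun {X x} hx =>
    (spectrum.norm_le_norm_mul_of_mem hx).trans (mul_le_of_le_one_right (norm_nonneg _) hone)
  let u : (H →L[ℂ] H)ˣ := ⟨B, C, hBC, hCB⟩
  intro x hx
  have h0 : 0 ≤ x := spectrum_nonneg_of_nonneg hB hx
  have hx0 : x ≠ 0 := spectrum.ne_zero_of_mem_of_unit (a := u) hx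
  have hpos : 0 < x := lt_of_le_of_ne h0 hx0.symm
  have hx' : x⁻¹ ∈ spectrum ℝ C :=
    spectrum.inv_mem_iff (r := Units.mk0 x hx0) (a := u) |>.1 hx
  refine ⟨?_, (le_abs_self x).trans ((hle hx).trans hb)⟩
  exact inv_le_of_inv_le₀ hpos ((le_abs_self _).trans ((hle hx').trans hc))

/-- Since `log |A|² = 2 log |A|`, the square root disappears; unlike `|A|`, `A*A` is visibly an
integrated form. -/
lemma detInv_eq_exp_half (ξ : H) {A : H →L[ℂ] H} (hA : IsUnit A) :
    detInv ξ A = Real.exp ((vectorTrace ξ (CFC.log (star A * A))).re / 2) := by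
  have hp : IsStrictlyPositive (CFC.abs A) := by
    refine ⟨CFC.abs_nonneg A, (isUnit_pow_iff two_ne_zero).1 ?_⟩
    rw [CFC.abs_sq]
    exact hA.star.mul hA
  rw [detInv, ← CFC.abs_sq, CFC.log_pow' 2 _ hp, two_nsmul, vectorTrace_add, Complex.add_re]
  ring_nf

lemma exp_apply_of_apply_eq_smul {X : H →L[ℂ] H} {v : H} {c : ℂ} (h : X v = c • v) :
    NormedSpace.exp X v = Complex.exp c • v := by
  have hpow : ∀ n : ℕ, (X ^ n) v = c ^ n • v := by
    intro n
    induction n with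
    | zero => simp
    | succ n ih => rw [pow_succ', mul_apply_eq_comp, ih, map_smul, h, smul_smul, pow_succ]
  have h1 := (NormedSpace.exp_series_hasSum_exp' (𝕂 := ℂ) X).mapL
    (ContinuousLinearMap.apply ℂ H v)
  have h2 := (NormedSpace.exp_series_hasSum_exp' (𝕂 := ℂ) c).smul_const v
  rw [← Complex.exp_eq_exp_ℂ] at h2
  refine h1.unique (h2.congr_fun ?_)
  intro n
  simp [hpow, smul_smul]

lemma commute_absAdd {A T : H →L[ℂ] H} (hT : Commute (star A * A) T) (ε : ℝ) :
    Commute (absAdd A ε) T :=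
  Commute.add_left (hT.cfcₙ_nnreal _) (Algebra.commute_algebraMap_left _ _)

end Approximation

/-! ### Determinant and trace in finite dimension -/

section FiniteDimensional

variable {H : Type*} [NormedAddCommGroup H] [InnerProductSpace ℂ H] [FiniteDimensional ℂ H]
  [CompleteSpace H]

lemma det_exp_of_isSelfAdjoint {X : H →L[ℂ] H} (hX : IsSelfAdjoint X) :
    LinearMap.det ((NormedSpace.exp X : H →L[ℂ] H) : H →ₗ[ℂ] H) =
      Complex.exp (LinearMap.trace ℂ H (X : H →ₗ[ℂ] H)) := by
  have hs : (X : H →ₗ[ℂ] H).IsSymmetric := hX.isSymmetric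
  set b := hs.eigenvectorBasis rfl
  have hb : ∀ i, X (b i) = (hs.eigenvalues rfl i : ℂ) • b i := hs.apply_eigenvectorBasis rfl
  have hM : LinearMap.toMatrix b.toBasis b.toBasis
      ((NormedSpace.exp X : H →L[ℂ] H) : H →ₗ[ℂ] H) =
      Matrix.diagonal fun i => Complex.exp (hs.eigenvalues rfl i : ℂ) := by
    ext i j
    rw [LinearMap.toMatrix_apply, OrthonormalBasis.coe_toBasis, ContinuousLinearMap.coe_coe,
      exp_apply_of_apply_eq_smul (hb j), map_smul, ← OrthonormalBasis.coe_toBasis,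
      Module.Basis.repr_self]
    by_cases hij : i = j
    · subst hij; simp
    · simp [Matrix.diagonal_apply_ne _ hij, Ne.symm hij]
  rw [← LinearMap.det_toMatrix b.toBasis, hM, Matrix.det_diagonal,
    hs.trace_eq_sum_eigenvalues rfl, ← Complex.exp_sum]
  simp

lemma norm_det_star (A : H →L[ℂ] H) : ‖(star A).det‖ = ‖A.det‖ := by
  let b := stdOrthonormalBasis ℂ H
  have h : LinearMap.det ((star A : H →L[ℂ] H) : H →ₗ[ℂ] H) =
      star (LinearMap.det (A : H →ₗ[ℂ] H)) := by
    rw [← LinearMap.det_toMatrix b.toBasis, ← LinearMap.det_toMatrix b.toBasis,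
      ← Matrix.det_conjTranspose, ← LinearMap.toMatrix_adjoint]
    rfl
  rw [ContinuousLinearMap.det, ContinuousLinearMap.det, h, norm_star]

lemma norm_det_abs (A : H →L[ℂ] H) : ‖(CFC.abs A).det‖ = ‖A.det‖ := by
  have hmul : ∀ X Y : H →L[ℂ] H, (X * Y).det = X.det * Y.det := fun X Y =>
    LinearMap.det_comp (X : H →ₗ[ℂ] H) Y
  have h : ‖(CFC.abs A * CFC.abs A).det‖ = ‖(star A * A).det‖ := by
    rw [← sq, CFC.abs_sq]
  rw [hmul, hmul, norm_mul, norm_mul, norm_det_star] at h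
  exact (mul_self_inj (norm_nonneg _) (norm_nonneg _)).1 h

/-- If `N τ` agrees with the ordinary trace on the bicommutant of `|A|`, then the determinant
formed with `τ` is the `N`-th root of the ordinary one. -/
theorem vectorDet_eq_norm_det_rpow {ξ : H} {A : H →L[ℂ] H} {N : ℕ} (hN : N ≠ 0)
    (htr : ∀ X : H →L[ℂ] H, (∀ T, Commute (star A * A) T → Commute X T) →
      LinearMap.trace ℂ H (X : H →ₗ[ℂ] H) = N * vectorTrace ξ X) :
    vectorDet ξ A = ‖A.det‖ ^ (1 / (N : ℝ)) := by
  have hcont : Continuous fun ε : ℝ => ‖(absAdd A ε).det‖ ^ (1 / (N : ℝ)) := by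
    have h1 : Continuous fun ε : ℝ => absAdd A ε := by
      unfold absAdd
      fun_prop
    exact (ContinuousLinearMap.continuous_det.comp h1).norm.rpow_const
      -- The exponent is nonnegative, so the root stays continuous where the determinant vanishes.
      fun _ => Or.inr (by positivity)
  have h0 : ‖(absAdd A 0).det‖ = ‖A.det‖ := by
    rw [absAdd, map_zero, add_zero, norm_det_abs]
  rw [← h0]
  refine tendsto_nhds_unique (tendsto_vectorDet ξ A)
    (((hcont.tendsto 0).mono_left nhdsWithin_le_nhds).congr' ?_)
  filter_upwards [self_mem_nhdsWithin] with ε hε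
  have hP := absAdd_pos A hε
  have hN' : (N : ℝ) ≠ 0 := Nat.cast_ne_zero.2 hN
  have hdet := det_exp_of_isSelfAdjoint (X := CFC.log (absAdd A ε)) IsSelfAdjoint.log
  -- `log (|A| + ε)` commutes with everything that commutes with `A*A`, so `htr` applies to it.
  rw [CFC.exp_log _ hP,
    htr (CFC.log (absAdd A ε)) fun T hT => (commute_absAdd hT ε).cfc_real _] at hdet
  rw [detInv, CFC.abs_of_nonneg _ hP.nonneg, ContinuousLinearMap.det, hdet, Complex.norm_exp,
    ← Real.exp_mul]
  congr 1
  simp only [Complex.mul_re, Complex.natCast_re, Complex.natCast_im, zero_mul, sub_zero]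
  field_simp

end FiniteDimensional

/-! ### Finite groups -/

section Finite

variable {G : Type*} [Group G]

lemma leftTranslation_single [DecidableEq G] (γ : G) :
    leftTranslation γ unitVector = (lp.single 2 γ (1 : ℂ) : L2 G) := by
  refine lp.ext (funext fun η => ?_)
  rw [leftTranslation_apply, unitVector_apply, lp.single_apply]
  by_cases h : η = γ
  · subst h; simp
  · have : ¬ γ⁻¹ * η = 1 := fun h' => h (inv_mul_eq_one.1 h').symm
    simp [h, this]

lemma inner_leftTranslation (γ : G) (x y : L2 G) :
    inner ℂ (leftTranslation γ x) (leftTranslation γ y) = inner ℂ x y :=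
  (permute (Equiv.mulLeft γ⁻¹)).inner_map_map x y

lemma star_coe_regular (h : L1 G) :
    star (regular h : L2 G →L[ℂ] L2 G) = regular (involution h) := by
  rw [coe_regular, coe_regular, integrated_involution star_rightRegular]

lemma commute_star_mul_self_regular (h : L1 G) (γ : G) :
    Commute (star (regular h : L2 G →L[ℂ] L2 G) * regular h) (leftTranslation γ) := by
  rw [star_coe_regular]
  exact ((Subalgebra.mem_centralizer_iff ℂ).1
    (mul_mem (regular (involution h)).2 (regular h).2) _ ⟨γ, rfl⟩).symm

variable [Finite G]

instance : FiniteDimensional ℂ (L2 G) :=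
  let := Fintype.ofFinite G
  LinearEquiv.finiteDimensional
    (lpPiLpₗᵢ (fun _ : G => ℂ) ℂ (p := 2)).symm.toLinearEquiv

/-- The standard basis consists of the left translates of `e`, so all diagonal entries of `X` equal
`τ(X)`. -/
lemma trace_eq_card_mul_vectorTrace {X : L2 G →L[ℂ] L2 G}
    (hX : ∀ γ, Commute X (leftTranslation γ)) :
    LinearMap.trace ℂ (L2 G) (X : L2 G →ₗ[ℂ] L2 G) = Nat.card G * vectorTrace unitVector X := by
  classical
  let := Fintype.ofFinite G
  let b : OrthonormalBasis G ℂ (L2 G) :=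
    (EuclideanSpace.basisFun G ℂ).map (lpPiLpₗᵢ (fun _ : G => ℂ) ℂ (p := 2)).symm
  have hb : ∀ γ, b γ = leftTranslation γ unitVector := by
    intro γ
    rw [leftTranslation_single]
    refine lp.ext (funext fun η => ?_)
    rw [lp.single_apply]
    have : b γ η = EuclideanSpace.single γ (1 : ℂ) η := by
      rw [← EuclideanSpace.basisFun_apply]
      rfl
    simp [this, Pi.single_apply]
  have hi : ∀ γ, inner ℂ (b γ) (X (b γ)) = vectorTrace unitVector X := by
    intro γ
    have := congrArg (fun T : L2 G →L[ℂ] L2 G => T unitVector) (hX γ)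
    simp only [mul_apply_eq_comp] at this
    rw [hb, this, inner_leftTranslation, vectorTrace]
  rw [LinearMap.trace_eq_sum_inner _ b]
  simp [hi]

theorem fkDet_regular_eq (h : L1 G) :
    fkDet (regular h) = ‖finiteDet h‖ ^ (1 / (Nat.card G : ℝ)) :=
  vectorDet_eq_norm_det_rpow Nat.card_pos.ne' fun _ hX =>
    trace_eq_card_mul_vectorTrace fun γ => hX _ (commute_star_mul_self_regular h γ)

end Finite

/-! ### Residually finite groups -/

theorem exists_tendsToTrivial (Γ : Type*) [Group Γ] [Countable Γ] [Group.ResiduallyFinite Γ] :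
    ∃ K : ℕ → Subgroup Γ, (∀ n, (K n).Normal) ∧ (∀ n, (K n).FiniteIndex) ∧ TendsToTrivial K := by
  obtain ⟨e, he⟩ := exists_surjective_nat Γ
  have hN : ∀ γ : Γ, ∃ N : FiniteIndexNormalSubgroup Γ, γ ≠ 1 → γ ∉ N := fun γ => by
    by_cases hγ : γ = 1
    · exact ⟨⟨⊤, inferInstance, inferInstance⟩, fun h => (h hγ).elim⟩
    · obtain ⟨N, hN⟩ := Group.exists_finiteIndexNormalSubgroup_notMem γ hγ
      exact ⟨N, fun _ => hN⟩
  choose N hN using hN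
  -- A decreasing sequence: `K n` avoids every nontrivial element among the first `n + 1` of the
  -- enumeration.
  refine ⟨fun n => ⨅ i : Fin (n + 1), (N (e i)).toSubgroup, fun n => ?_, fun n => ?_, fun γ => ?_⟩
  · exact Subgroup.normal_iInf_normal fun i => (N (e i)).isNormal'
  · exact Subgroup.finiteIndex_iInf fun i => (N (e i)).isFiniteIndex'
  · constructor
    · intro hinf
      by_contra hγ
      obtain ⟨i, rfl⟩ := he γ
      obtain ⟨n, hn, hin⟩ := hinf.exists_gt i
      exact hN _ hγ ((Subgroup.mem_iInf.1 hn) ⟨i, by omega⟩)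
    · rintro rfl
      simpa [one_mem] using Set.infinite_univ

lemma TendsToTrivial.eventually_notMem {Γ : Type*} [Group Γ] {K : ℕ → Subgroup Γ}
    (hK : TendsToTrivial K) {γ : Γ} (hγ : γ ≠ 1) : ∀ᶠ n in atTop, γ ∉ K n := by
  have h := Set.not_infinite.1 (mt (hK γ).1 hγ)
  rw [← Nat.cofinite_eq_atTop]
  simpa [Filter.Eventually, Filter.mem_cofinite, Set.compl_ofPred] using h

/-! ### Uniform spectral bounds and approximation of the determinant -/

section Approximation

variable {Γ : Type*} [Group Γ] {H : Type*} [NormedAddCommGroup H] [InnerProductSpace ℂ H]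
  [CompleteSpace H] {v : Γ →* (H →L[ℂ] H)}

lemma integrated_conv_involution (hv : ∀ γ, ‖v γ‖ ≤ 1) (hstar : ∀ γ, star (v γ) = v γ⁻¹)
    (f : L1 Γ) :
    integrated v (conv (involution f) f) = star (integrated v f) * integrated v f := by
  rw [integrated_conv hv, integrated_involution hstar]

lemma integrated_mul_eq_one (hv : ∀ γ, ‖v γ‖ ≤ 1) {f g : L1 Γ} (h : conv f g = one) :
    integrated v f * integrated v g = 1 := by
  rw [← integrated_conv hv, h, integrated_one]

lemma spectrum_integrated_subset (hv : ∀ γ, ‖v γ‖ ≤ 1) (hstar : ∀ γ, star (v γ) = v γ⁻¹)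
    {f g : L1 Γ} (hfg : conv f g = one) (hgf : conv g f = one) :
    spectrum ℝ (integrated v (conv (involution f) f)) ⊆
      Set.Icc (∑' γ, ‖conv g (involution g) γ‖)⁻¹ (∑' γ, ‖conv (involution f) f γ‖) := by
  have h1 := integrated_mul_eq_one hv hfg
  have h2 := integrated_mul_eq_one hv hgf
  have hk : integrated v (conv g (involution g)) = integrated v g * star (integrated v g) := by
    rw [integrated_conv hv, integrated_involution hstar]
  have hh := integrated_conv_involution hv hstar f
  refine spectrum_subset_Icc (C := integrated v (conv g (involution g))) ?_ ?_ ?_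
    (norm_integrated_le hv _) (norm_integrated_le hv _)
  · rw [hh]
    exact star_mul_self_nonneg _
  · rw [hh, hk, mul_assoc, ← mul_assoc (integrated v f), h1, one_mul, ← star_mul, h2, star_one]
  · rw [hh, hk, mul_assoc, ← mul_assoc (star (integrated v g)), ← star_mul, h1, star_one, one_mul,
      h2]

lemma vectorDet_integrated (hv : ∀ γ, ‖v γ‖ ≤ 1) (hstar : ∀ γ, star (v γ) = v γ⁻¹)
    {f : L1 Γ} (hf : IsL1Unit f) (ξ : H) :
    vectorDet ξ (integrated v f) =
      Real.exp ((vectorTrace ξ (cfc Real.log (integrated v (conv (involution f) f)))).re / 2) := by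
  obtain ⟨g, hfg, hgf⟩ := hf
  have hunit : IsUnit (integrated v f) :=
    ⟨⟨_, _, integrated_mul_eq_one hv hfg, integrated_mul_eq_one hv hgf⟩, rfl⟩
  rw [vectorDet_eq_detInv ξ _ hunit, detInv_eq_exp_half ξ hunit,
    integrated_conv_involution hv hstar, CFC.log]

end Approximation

theorem tendsto_fkDet_pushforward {Γ : Type*} [Group Γ] {Γ' : ℕ → Type*} [∀ n, Group (Γ' n)]
    (φ : ∀ n, Γ →* Γ' n) (hφ : ∀ γ, γ ≠ 1 → ∀ᶠ n in atTop, φ n γ ≠ 1) {f : L1 Γ}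
    (hf : IsL1Unit f) :
    Tendsto (fun n => fkDet (regular (pushforward (φ n) f))) atTop (𝓝 (fkDet (regular f))) := by
  have hu : ∀ n γ, ‖(rightRegular (Γ' n)).comp (φ n) γ‖ ≤ 1 := fun n γ => norm_rightRegular_le _
  have hus : ∀ n γ, star ((rightRegular (Γ' n)).comp (φ n) γ) =
      (rightRegular (Γ' n)).comp (φ n) γ⁻¹ := fun n γ => by
    simp only [MonoidHom.comp_apply, star_rightRegular, map_inv]
  simp only [fkDet, coe_regular, integrated_pushforward _ norm_rightRegular_le]
  simp only [vectorDet_integrated (hu _) (hus _) hf,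
    vectorDet_integrated norm_rightRegular_le star_rightRegular hf]
  obtain ⟨g, hfg, hgf⟩ := hf
  set h : L1 Γ := conv (involution f) f
  -- Keeps the interval away from the singularity of `log`: otherwise `r(g) r(g)* = 0`, so `r(g) =
  -- 0` and `1 = r(g) r(f) = 0`, against `‖e‖ = 1`.
  have hk : 0 < ∑' γ, ‖conv g (involution g) γ‖ := by
    have h1 := integrated_mul_eq_one norm_rightRegular_le hgf
    have h2 := norm_integrated_le norm_rightRegular_le (conv g (involution g))
    refine lt_of_lt_of_le (norm_pos_iff.2 fun h0 => ?_) h2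
    rw [integrated_conv norm_rightRegular_le, integrated_involution star_rightRegular,
      CStarRing.mul_star_self_eq_zero_iff] at h0
    rw [h0, zero_mul] at h1
    have h3 := norm_unitVector (Γ := Γ)
    rw [← ContinuousLinearMap.id_apply (R₁ := ℂ) (unitVector : L2 Γ),
      ← ContinuousLinearMap.one_def, ← h1] at h3
    simp at h3
  have hlog : ContinuousOn Real.log
      (Set.Icc (∑' γ, ‖conv g (involution g) γ‖)⁻¹ (∑' γ, ‖h γ‖)) :=
    Real.continuousOn_log.mono fun x hx => ((inv_pos.2 hk).trans_le hx.1).ne'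
  refine (Real.continuous_exp.tendsto _).comp (((Complex.continuous_re.tendsto _).comp
    (tendsto_vectorTrace_cfc norm_unitVector ?_ (fun _ => norm_unitVector) (fun n => ?_)
      (spectrum_integrated_subset norm_rightRegular_le star_rightRegular hfg hgf)
      (fun n => spectrum_integrated_subset (hu n) (hus n) hfg hgf) hlog fun m => ?_)).div_const 2)
  · rw [integrated_conv_involution norm_rightRegular_le star_rightRegular]
    exact IsSelfAdjoint.star_mul_self _
  · rw [integrated_conv_involution (hu n) (hus n)]
    exact IsSelfAdjoint.star_mul_self _
  -- The `m`-th powers are integrated forms of the same convolution power of `h` for all `n`.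
  · simp only [← integrated_convPow (hu _), ← integrated_convPow norm_rightRegular_le]
    exact tendsto_vectorTrace_integrated φ hφ _

end GroupVN

end

theorem mainTheorem6 :
    (∀ (Γ : Type*) [Group Γ] [Countable Γ] [Group.ResiduallyFinite Γ],
      (∃ K : ℕ → Subgroup Γ, (∀ n, (K n).Normal) ∧ (∀ n, (K n).FiniteIndex) ∧
        GroupVN.TendsToTrivial K) ∧
      ∀ (K : ℕ → Subgroup Γ) [∀ n, (K n).Normal] [∀ n, (K n).FiniteIndex],
        GroupVN.TendsToTrivial K →
        ∀ f : GroupVN.L1 Γ, GroupVN.IsL1Unit f →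
          Filter.Tendsto
            (fun n => ‖GroupVN.finiteDet (GroupVN.pushforward (QuotientGroup.mk' (K n)) f)‖ ^
              (1 / (Nat.card (Γ ⧸ K n) : ℝ)))
            Filter.atTop (nhds (GroupVN.fkDet (GroupVN.regular f)))) ∧
    (∀ (G : Type*) [Group G] [Finite G] (h : GroupVN.L1 G),
      GroupVN.fkDet (GroupVN.regular h) =
        ‖GroupVN.finiteDet h‖ ^ (1 / (Nat.card G : ℝ))) := by
  refine ⟨fun Γ _ _ _ => ⟨GroupVN.exists_tendsToTrivial Γ, fun K _ _ hK f hf => ?_⟩,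
    fun G _ _ h => GroupVN.fkDet_regular_eq h⟩
  refine (GroupVN.tendsto_fkDet_pushforward (fun n => QuotientGroup.mk' (K n))
    (fun γ hγ => ?_) hf).congr fun n => GroupVN.fkDet_regular_eq _
  filter_upwards [hK.eventually_notMem hγ] with n hn
  simpa using hn
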